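/- **Setting (random corruption model).** Let $m\ge 2$ be a fixed integer and identify the alphabet $[m]=\{1,\dots,m\}$ with $\mathbb{Z}/m\mathbb{Z}$. For unknown $x=(x_1,\dots,x_n)\in[m]^n$, each pair $(i,j)$ with $1\le j<i\le n$ is included in a random set $\Omega$ independently with probability $p_{\mathrm{obs}}\in[0,1]$, and for each $(i,j)\in\Omega$ one observes $$y_{i,j}=\begin{cases}x_i-x_j \bmod m & \text{with probability }\pi_0,\\ \text{a uniformly random element of }\{0,1,\dots,m-1\} & \text{otherwise,}\end{cases}$$ where $\pi_0\in[0,1]$, the measurements are independent over pairs, and $\Omega$ is independent of the measurement noise. An assignment $x$ is represented by the block vector $\boldsymbol{x}\in\mathbb{R}^{mn}$ whose $i$-th block is the canonical basis vector $\boldsymbol e_{x_i}\in\mathbb{R}^m$. For $\hat{\boldsymbol x}\in\mathbb{R}^{mn}$ let $$\mathsf{MCR}(\hat{\boldsymbol x},\boldsymbol x)=\frac1n\min_{0\le l<m}\#\{i:\hat{\boldsymbol x}_i\neq \mathsf{shift}_l(\boldsymbol x_i)\},$$ where $\mathsf{shift}_l$ circularly shifts the entries of a vector in $\mathbb{R}^m$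 by $l$ positions. Both $p_{\mathrm{obs}}$ and $\pi_0$ may depend on $n$. **Theorem.** Fix an integer $m\ge2$ and a constant $\theta\in(0,1)$ (for instance $\theta=0.99$). There is a constant $c_1>0$ such that, if for all sufficiently large $n$ $$p_{\mathrm{obs}}>\frac{c_1\log n}{n}\qquad\text{and}\qquad \pi_0<2\sqrt{\frac{\theta\log n}{m\,n\,p_{\mathrm{obs}}}},$$ then the minimax probability of error satisfies $$\inf_{\hat{\boldsymbol x}}\ \max_{x\in[m]^n}\ \mathbb{P}\left(\mathsf{MCR}(\hat{\boldsymbol x},\boldsymbol x)>0\mid \boldsymbol x\right)\longrightarrow 1\qquad\text{as }n\to\infty,$$ where the infimum is over all estimators, that is, all (possibly randomized) measurable functions $\hat{\boldsymbol x}$ of the data $(\Omega,\{y_{i,j}\}_{(i,j)\in\Omega})$ with values in $\mathbb{R}^{mn}$. -/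

import Mathlib

open MeasureTheory ProbabilityTheory Filter Topology
open scoped ENNReal

noncomputable section

namespace JointAlignment

/-- The alphabet `[m]` is represented by the residues modulo `m`, so that `xᵢ - xⱼ` is the
difference modulo `m`. An observation attached to a pair is `some y` if the pair is sampled and
the measurement is `y`, and `none` if the pair is not sampled. -/
abbrev Sample (m : ℕ) : Type := Option (ZMod m)

/-- Every subset of the finite set of possible samples is measurable. -/
instance instMeasurableSpaceSample (m : ℕ) : MeasurableSpace (Sample m) := ⊤

/-- The pairs `(i, j)` with `i > j`. -/
abbrev Pair (n : ℕ) : Type := {e : Fin n × Fin n // e.2 < e.1}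

/-- The whole data set: the sampled set of pairs together with the measurements on it. -/
abbrev Data (n m : ℕ) : Type := Pair n → Sample m

/-- Random corruption: the law of a measurement of a difference equal to `l`. It is `l` with
probability `π₀`, and otherwise uniformly distributed on the alphabet. -/
def measurementLaw {m : ℕ} [NeZero m] (π₀ : ℝ) (l : ZMod m) : Measure (ZMod m) :=
  ENNReal.ofReal π₀ • Measure.dirac l +
    ENNReal.ofReal (1 - π₀) • (PMF.uniformOfFintype (ZMod m)).toMeasure

/-- The law of the observation attached to a pair whose true difference is `l`: the pair is
sampled with probability `p`, independently of the measurement. -/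
def sampleLaw {m : ℕ} [NeZero m] (p π₀ : ℝ) (l : ZMod m) : Measure (Sample m) :=
  ENNReal.ofReal p • (measurementLaw π₀ l).map some +
    ENNReal.ofReal (1 - p) • Measure.dirac none

/-- The law of the data when the true assignment is `x`: the observations attached to the pairs
`(i, j)`, `i > j`, are independent. -/
def dataLaw {n m : ℕ} [NeZero m] (p π₀ : ℝ) (x : Fin n → ZMod m) : Measure (Data n m) :=
  Measure.pi fun e : Pair n => sampleLaw p π₀ (x e.1.1 - x e.1.2)

/-- Block vectors in `ℝ^{mn}`, with `n` blocks of length `m`. -/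
abbrev BlockVec (n m : ℕ) : Type := Fin n → ZMod m → ℝ

/-- The vector representation of an assignment: the block `i` is the canonical basis vector
of index `x i`. -/
def vec {n m : ℕ} (x : Fin n → ZMod m) : BlockVec n m :=
  fun i => Pi.single (x i) 1

/-- Circular shift by `l` positions of every block. -/
def shift {n m : ℕ} (l : ZMod m) (z : BlockVec n m) : BlockVec n m :=
  fun i a => z i (a - l)

/-- Block sparsity: the number of nonzero blocks. -/
def blockSparsity {n m : ℕ} (h : BlockVec n m) : ℕ :=
  {i | h i ≠ 0}.ncard

/-- The misclassification rate, modulo the global shift. The infimum is over a nonempty set of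
natural numbers, hence it is a minimum. -/
def MCR {n m : ℕ} (z x : BlockVec n m) : ℝ :=
  1 / (n : ℝ) * ((⨅ l : ZMod m, blockSparsity (z - shift l x) : ℕ) : ℝ)

/-- The probability that the estimator `κ` does not recover `x` exactly (up to a global shift).
An estimator may use additional randomness: it is a Markov kernel from the data to the block
vectors. The estimators that are functions of the data are the deterministic kernels. -/
def errorProb {n m : ℕ} [NeZero m] (p π₀ : ℝ) (κ : Kernel (Data n m) (BlockVec n m))
    (x : Fin n → ZMod m) : ℝ≥0∞ :=
  ∫⁻ y, κ y {z | 0 < MCR z (vec x)} ∂(dataLaw p π₀ x)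

/-- The minimax probability of error: the infimum over all estimators of the worst-case
probability of failing to recover exactly. -/
def minimaxError (n m : ℕ) [NeZero m] (p π₀ : ℝ) : ℝ≥0∞ :=
  ⨅ (κ : Kernel (Data n m) (BlockVec n m)) (_ : IsMarkovKernel κ),
    ⨆ x : Fin n → ZMod m, errorProb p π₀ κ x

end JointAlignment

end

/-! Fix one letter to be 0 and put the uniform prior on the remaining assignments. Their shift
orbits are disjoint, so for given data the success probabilities of an estimator sum to at most 1,
and its total success is at most the sum over the data of the largest likelihood. It therefore
suffices that, under each truth, some other normalized assignment is strictly more likely with high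
probability (`one_le_minimaxError_add`).

The competitors change one letter `i` by 1, with `i` in a set `S` of about `ε n` letters. The
log-likelihood ratio is a positive multiple of a lazy walk over the pairs at `i`, with steps +1 of
probability `q` and -1 of probability `r = q + p π₀`. Pairs joining `i` to `Sᶜ` are disjoint for
different `i`, so the outer scores are independent. Pairs inside `S` are too few to matter: once
some outer score is high, independence allows one such `i` to be selected before the inner pairs are
inspected, so a single Chebyshev bound replaces a union bound (`pi_forall_notMem_inter_le`).

An outer score is high with probability at least about `exp (-n (√r - √q) ^ 2)`, by exponential
tilting with Chebyshev under the tilted law (`le_measureReal_tilted`, `exists_tilt`). The signal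
bound gives `n (√r - √q) ^ 2 ≲ θ log n`. With `1 - θ = 8 β` and losses of `3 β` in the exponent, the
expected number of high outer scores is at least of order `n ^ (5 β)`, so one occurs with high
probability. At `π₀ = 0` no likelihood is strictly larger; that case is handled separately by
counting. -/

noncomputable section

namespace JointAlignment

/-! ### Exponential tilting and Chebyshev's inequality. -/

section Tilting

variable {Ω ι : Type*} [Finite Ω] [MeasurableSpace Ω] [MeasurableSingletonClass Ω]
  {P : Measure Ω} [IsProbabilityMeasure P] {X : ι → Ω → ℝ}

/-- The exponentially tilted moments of order at most two of a sum of independent variables whose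
tilted mean is `μ`. -/
theorem tilted_moments_sum (hX : iIndepFun X P) {t M μ v : ℝ} {s : Finset ι}
    (h0 : ∀ j ∈ s, ∫ ω, Real.exp (t * X j ω) ∂P = M)
    (h1 : ∀ j ∈ s, ∫ ω, Real.exp (t * X j ω) * (X j ω - μ) ∂P = 0)
    (h2 : ∀ j ∈ s, ∫ ω, Real.exp (t * X j ω) * (X j ω - μ) ^ 2 ∂P = v * M) :
    ∫ ω, Real.exp (t * ∑ j ∈ s, X j ω) ∂P = M ^ s.card ∧
    ∫ ω, Real.exp (t * ∑ j ∈ s, X j ω) * (∑ j ∈ s, X j ω - s.card * μ) ∂P = 0 ∧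
    ∫ ω, Real.exp (t * ∑ j ∈ s, X j ω) * (∑ j ∈ s, X j ω - s.card * μ) ^ 2 ∂P =
      s.card * v * M ^ s.card := by
  classical
  induction s using Finset.induction_on with
  | empty => simp
  | insert i s hi ih =>
    obtain ⟨i0, i1, i2⟩ := ih (fun j hj => h0 j (by simp [hj])) (fun j hj => h1 j (by simp [hj]))
      (fun j hj => h2 j (by simp [hj]))
    have hind := hX.indepFun_finsetSum_of_notMem (fun j => measurable_of_finite _) hi
    have key : ∀ f g : ℝ → ℝ, Measurable f → Measurable g →
        ∫ ω, f (∑ j ∈ s, X j ω) * g (X i ω) ∂P =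
          (∫ ω, f (∑ j ∈ s, X j ω) ∂P) * ∫ ω, g (X i ω) ∂P := by
      intro f g hf hg
      have := (hind.comp hf hg).integral_fun_mul_eq_mul_integral
        (measurable_of_finite _).aestronglyMeasurable (measurable_of_finite _).aestronglyMeasurable
      simpa [Function.comp_def, Finset.sum_apply] using this
    have j0 := h0 i (by simp)
    have j1 := h1 i (by simp)
    have j2 := h2 i (by simp)
    have k00 := key (fun w => Real.exp (t * w)) (fun w => Real.exp (t * w))
      (by fun_prop) (by fun_prop)
    have k10 := key (fun w => Real.exp (t * w) * (w - s.card * μ)) (fun w => Real.exp (t * w))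
      (by fun_prop) (by fun_prop)
    have k01 := key (fun w => Real.exp (t * w)) (fun w => Real.exp (t * w) * (w - μ))
      (by fun_prop) (by fun_prop)
    have k11 := key (fun w => Real.exp (t * w) * (w - s.card * μ))
      (fun w => Real.exp (t * w) * (w - μ)) (by fun_prop) (by fun_prop)
    have k20 := key (fun w => Real.exp (t * w) * (w - s.card * μ) ^ 2) (fun w => Real.exp (t * w))
      (by fun_prop) (by fun_prop)
    have k02 := key (fun w => Real.exp (t * w)) (fun w => Real.exp (t * w) * (w - μ) ^ 2)
      (by fun_prop) (by fun_prop)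
    simp only [i0, i1, i2, j0, j1, j2] at k00 k10 k01 k11 k20 k02
    simp only [Finset.sum_insert hi, Finset.card_insert_of_notMem hi]
    refine ⟨?_, ?_, ?_⟩
    · rw [pow_succ, ← k00]
      refine integral_congr_ae (.of_forall fun ω => ?_)
      simp only [mul_add, Real.exp_add]; ring
    · have : (0 : ℝ) = 0 * M + M ^ s.card * 0 := by ring
      rw [this, ← k10, ← k01, ← integral_add .of_finite .of_finite]
      refine integral_congr_ae (.of_forall fun ω => ?_)
      simp only [mul_add, Real.exp_add]; push_cast; ring
    -- Expansion of the square of the recentred sum: the cross term is twice a product of two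
    -- vanishing tilted first moments.
    · have : ((s.card + 1 : ℕ) : ℝ) * v * M ^ (s.card + 1) =
          s.card * v * M ^ s.card * M + 2 * (0 * 0) + M ^ s.card * (v * M) := by
        push_cast; ring
      rw [this, ← k20, ← k11, ← k02, ← integral_const_mul, ← integral_add .of_finite .of_finite,
        ← integral_add .of_finite .of_finite]
      refine integral_congr_ae (.of_forall fun ω => ?_)
      simp only [mul_add, Real.exp_add]; push_cast; ring

/-- Lower tail bound for the tilted sum: Chebyshev's inequality under the tilted law. -/
theorem le_measureReal_tilted (hX : iIndepFun X P) {t M μ v h : ℝ} {s : Finset ι}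
    (ht : 0 ≤ t) (hh : 0 < h)
    (h0 : ∀ j ∈ s, ∫ ω, Real.exp (t * X j ω) ∂P = M)
    (h1 : ∀ j ∈ s, ∫ ω, Real.exp (t * X j ω) * (X j ω - μ) ∂P = 0)
    (h2 : ∀ j ∈ s, ∫ ω, Real.exp (t * X j ω) * (X j ω - μ) ^ 2 ∂P = v * M) :
    M ^ s.card * (1 - s.card * v / h ^ 2) * Real.exp (-(t * (s.card * μ + h))) ≤
      P.real {ω | s.card * μ - h ≤ ∑ j ∈ s, X j ω} := by
  obtain ⟨i0, -, i2⟩ := tilted_moments_sum hX h0 h1 h2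
  set W : Ω → ℝ := fun ω => ∑ j ∈ s, X j ω
  set A : Set Ω := {ω | s.card * μ - h ≤ W ω}
  have hA : MeasurableSet A := A.toFinite.measurableSet
  rw [Real.exp_neg, ← div_eq_mul_inv, div_le_iff₀ (Real.exp_pos _)]
  calc M ^ s.card * (1 - s.card * v / h ^ 2)
      = ∫ ω, Real.exp (t * W ω) ∂P
        - (1 / h ^ 2) * ∫ ω, Real.exp (t * W ω) * (W ω - s.card * μ) ^ 2 ∂P := by
          rw [i0, i2]; ring
    _ = ∫ ω, (Real.exp (t * W ω)
        - (1 / h ^ 2) * (Real.exp (t * W ω) * (W ω - s.card * μ) ^ 2)) ∂P := by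
          rw [integral_sub .of_finite .of_finite, integral_const_mul]
    _ ≤ ∫ ω, A.indicator (fun _ => Real.exp (t * (s.card * μ + h))) ω ∂P := by
          refine integral_mono .of_finite .of_finite fun ω => ?_
          have e : Real.exp (t * W ω)
              - (1 / h ^ 2) * (Real.exp (t * W ω) * (W ω - s.card * μ) ^ 2) =
              Real.exp (t * W ω) * (1 - (W ω - s.card * μ) ^ 2 / h ^ 2) := by ring
          simp only [e]
          -- Within distance `h` of the tilted mean the bracket is at most 1 and the exponential is
          -- at most its value at the upper end; farther away the bracket is nonpositive.
          by_cases hc : |W ω - s.card * μ| ≤ h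
          · have := abs_le.1 hc
            have hm : ω ∈ A := by simp only [A, Set.mem_ofPred_eq]; linarith
            rw [Set.indicator_of_mem hm]
            calc _ ≤ Real.exp (t * W ω) * 1 := by gcongr; linarith [show 0 ≤ (W ω - s.card * μ) ^ 2 / h ^ 2 by positivity]
              _ ≤ _ := by rw [mul_one]; gcongr; linarith
          · push Not at hc
            have h3 : 1 ≤ (W ω - s.card * μ) ^ 2 / h ^ 2 := by
              rw [one_le_div (by positivity), ← sq_abs (W ω - _)]
              gcongr
            refine le_trans (mul_nonpos_of_nonneg_of_nonpos (Real.exp_pos _).le (by linarith)) ?_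
            exact Set.indicator_nonneg (fun _ _ => (Real.exp_pos _).le) _
    _ = _ := by rw [integral_indicator_const _ hA, smul_eq_mul]

/-- Chebyshev's inequality for the lower tail of a sum of independent variables. -/
theorem measureReal_sum_le (hX : iIndepFun X P) {μ v h : ℝ} {s : Finset ι} (hh : 0 < h)
    (h1 : ∀ j ∈ s, ∫ ω, (X j ω - μ) ∂P = 0)
    (h2 : ∀ j ∈ s, ∫ ω, (X j ω - μ) ^ 2 ∂P = v) :
    P.real {ω | ∑ j ∈ s, X j ω ≤ s.card * μ - h} ≤ s.card * v / h ^ 2 := by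
  obtain ⟨-, -, i2⟩ := tilted_moments_sum (t := 0) (M := 1) (v := v) hX (s := s) (by simp)
    (by simpa using h1) (by simpa using h2)
  simp only [zero_mul, Real.exp_zero, one_mul, one_pow, mul_one] at i2
  set A : Set Ω := {ω | ∑ j ∈ s, X j ω ≤ s.card * μ - h}
  have hA : MeasurableSet A := A.toFinite.measurableSet
  rw [le_div_iff₀ (by positivity), ← i2, ← smul_eq_mul, ← integral_indicator_const _ hA]
  refine integral_mono .of_finite .of_finite fun ω => ?_
  by_cases hm : ω ∈ A
  · simp only [Set.indicator_of_mem hm]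
    have : ∑ j ∈ s, X j ω ≤ s.card * μ - h := hm
    nlinarith
  · simp only [Set.indicator_of_notMem hm]; positivity

end Tilting

/-! ### Tails of lazy random walks. -/

section Walk

variable {Ω ι : Type*} [Finite Ω] [MeasurableSpace Ω] [MeasurableSingletonClass Ω]
  {P : Measure Ω} [IsProbabilityMeasure P] {X : ι → Ω → ℝ}

/-- Lower bound on the upper tail of a lazy random walk. -/
theorem le_measureReal_walk (hX : iIndepFun X P) {q r t h : ℝ} {s : Finset ι}
    (ht : 0 ≤ t) (hh : 0 < h)
    (hlaw : ∀ j ∈ s, ∀ g : ℝ → ℝ,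
      ∫ ω, g (X j ω) ∂P = q * g 1 + r * g (-1) + (1 - q - r) * g 0)
    {M μ : ℝ} (hM : M = 1 - q - r + q * Real.exp t + r * Real.exp (-t)) (hM0 : 0 < M)
    (hμ : μ * M = q * Real.exp t - r * Real.exp (-t)) :
    M ^ s.card * (1 - s.card * ((q * Real.exp t + r * Real.exp (-t)) / M) / h ^ 2) *
        Real.exp (-(t * (s.card * μ + h))) ≤
      P.real {ω | s.card * μ - h ≤ ∑ j ∈ s, X j ω} := by
  have key := le_measureReal_tilted (P := P) (M := M) (μ := μ) (s := s) hX
    (v := ((q * Real.exp t + r * Real.exp (-t)) / M - μ ^ 2)) ht hh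
    (fun j hj => by rw [hlaw j hj (fun x => Real.exp (t * x))]; simp [hM]; ring)
    (fun j hj => by
      rw [hlaw j hj (fun x => Real.exp (t * x) * (x - μ))]
      simp only [mul_one, mul_neg, mul_zero, Real.exp_zero]
      linear_combination hμ * (-1) + μ * hM)
    (fun j hj => by
      rw [hlaw j hj (fun x => Real.exp (t * x) * (x - μ) ^ 2)]
      simp only [mul_one, mul_neg, mul_zero, Real.exp_zero]
      have : (q * Real.exp t + r * Real.exp (-t)) / M * M =
        q * Real.exp t + r * Real.exp (-t) := by field_simp
      linear_combination -this + 2 * μ * hμ - μ ^ 2 * hM)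
  refine le_trans ?_ key
  gcongr
  nlinarith [sq_nonneg μ]

/-- Upper bound on the lower tail of a lazy random walk. -/
theorem measureReal_walk_le (hX : iIndepFun X P) {q r h : ℝ} {s : Finset ι} (hh : 0 < h)
    (hlaw : ∀ j ∈ s, ∀ g : ℝ → ℝ,
      ∫ ω, g (X j ω) ∂P = q * g 1 + r * g (-1) + (1 - q - r) * g 0) :
    P.real {ω | ∑ j ∈ s, X j ω ≤ s.card * (q - r) - h} ≤ s.card * (q + r) / h ^ 2 := by
  have key := measureReal_sum_le (P := P) (μ := q - r) (v := q + r - (q - r) ^ 2) (s := s) hX hh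
    (fun j hj => by rw [hlaw j hj (fun x => x - (q - r))]; ring)
    (fun j hj => by rw [hlaw j hj (fun x => (x - (q - r)) ^ 2)]; ring)
  refine key.trans ?_
  gcongr
  nlinarith [sq_nonneg (q - r)]

end Walk

/-! ### Independence of events on disjoint coordinates. -/

section Product

variable {ι : Type*} [Fintype ι] {α : ι → Type*} [∀ i, Finite (α i)]
  [∀ i, MeasurableSpace (α i)] [∀ i, MeasurableSingletonClass (α i)]
  (μ : ∀ i, Measure (α i)) [∀ i, IsProbabilityMeasure (μ i)]

/-- Events that depend on disjoint sets of coordinates are independent. -/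
theorem pi_inter_of_dependsOn {S T : Finset ι} (hST : Disjoint S T) {A B : Set (∀ i, α i)}
    (hA : DependsOn (· ∈ A) (S : Set ι)) (hB : DependsOn (· ∈ B) (T : Set ι)) :
    (Measure.pi μ).real (A ∩ B) = (Measure.pi μ).real A * (Measure.pi μ).real B := by
  have hind : iIndepFun (fun i (y : ∀ i, α i) => y i) (Measure.pi μ) :=
    iIndepFun_pi (X := fun i (a : α i) => a) (fun i => aemeasurable_id)
  have h2 := hind.indepFun_finset S T hST (fun i => measurable_pi_apply i)
  have rep : ∀ (U : Finset ι) (C : Set (∀ i, α i)), DependsOn (· ∈ C) (U : Set ι) →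
      C = (fun (y : ∀ i, α i) (i : U) => y i) ⁻¹'
        ((fun (y : ∀ i, α i) (i : U) => y i) '' C) := by
    intro U C hC
    ext y
    constructor
    · intro hy; exact ⟨y, hy, rfl⟩
    · rintro ⟨z, hz, hzy⟩
      have : (z ∈ C) = (y ∈ C) := hC fun i hi => congrFun hzy ⟨i, hi⟩
      exact this ▸ hz
  have h3 := h2.measure_inter_preimage_eq_mul
    ((fun (y : ∀ i, α i) (i : S) => y i) '' A) ((fun (y : ∀ i, α i) (i : T) => y i) '' B)
    (Set.toFinite _).measurableSet (Set.toFinite _).measurableSet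
  rw [← rep S A hA, ← rep T B hB] at h3
  simp [measureReal_def, h3]

/-- Events that depend on pairwise disjoint sets of coordinates are independent. -/
theorem pi_biInter_of_dependsOn {κ : Type*} [DecidableEq ι] (s : Finset κ) {E : κ → Finset ι}
    (hE : (s : Set κ).PairwiseDisjoint E) {A : κ → Set (∀ i, α i)}
    (hA : ∀ k ∈ s, DependsOn (· ∈ A k) (E k : Set ι)) :
    (Measure.pi μ).real (⋂ k ∈ s, A k) = ∏ k ∈ s, (Measure.pi μ).real (A k) := by
  classical
  induction s using Finset.induction_on with
  | empty => simp
  | insert i s hi ih =>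
    rw [Finset.prod_insert hi, Finset.set_biInter_insert,
      pi_inter_of_dependsOn μ (S := E i) (T := s.biUnion E) ?_ (hA i (by simp)) ?_, ih]
    · exact hE.subset (by simp)
    · exact fun k hk => hA k (by simp [hk])
    · rw [Finset.disjoint_biUnion_right]
      intro k hk
      exact hE (by simp) (by simp [hk]) (by rintro rfl; exact hi hk)
    · intro y z hyz
      simp only [Set.mem_iInter, eq_iff_iff]
      refine forall₂_congr fun k hk => ?_
      exact (hA k (by simp [hk]) fun e he => hyz e (by simp; exact ⟨k, hk, he⟩)).to_iff

/-- If the events `A k` depend on pairwise disjoint sets of coordinates and have probability at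
least `a`, and if `I k` has probability at least `1 - δ` and depends on coordinates that do not
occur in the `A`, then some `A k ∩ I k` occurs with high probability. -/
theorem pi_forall_notMem_inter_le {κ : Type*} [DecidableEq ι] (s : Finset κ)
    {E F : κ → Finset ι}
    (hE : (s : Set κ).PairwiseDisjoint E) (hEF : ∀ k ∈ s, ∀ l ∈ s, Disjoint (E k) (F l))
    {A I : κ → Set (∀ i, α i)}
    (hA : ∀ k ∈ s, DependsOn (· ∈ A k) (E k : Set ι))
    (hI : ∀ k ∈ s, DependsOn (· ∈ I k) (F k : Set ι)) {a δ : ℝ}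
    (hAa : ∀ k ∈ s, a ≤ (Measure.pi μ).real (A k))
    (hIδ : ∀ k ∈ s, (Measure.pi μ).real (I k)ᶜ ≤ δ) (hδ : 0 ≤ δ) :
    (Measure.pi μ).real {y | ∀ k ∈ s, y ∉ A k ∩ I k} ≤ (Real.exp (-(a * s.card))) + δ := by
  classical
  have hms : ∀ C : Set (∀ i, α i), MeasurableSet C := fun C => C.toFinite.measurableSet
  have compl : ∀ (U : Finset ι) (C : Set (∀ i, α i)), DependsOn (· ∈ C) (U : Set ι) →
      DependsOn (· ∈ Cᶜ) (U : Set ι) := by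
    intro U C hC y z hyz
    have := hC hyz
    simp only [Set.mem_compl_iff]
    exact congrArg Not this
  set P := Measure.pi μ
  have hnone : P.real (⋂ k ∈ s, (A k)ᶜ) ≤ Real.exp (-(a * s.card)) := by
    rw [pi_biInter_of_dependsOn μ s hE (fun k hk => compl _ _ (hA k hk))]
    calc _ ≤ ∏ k ∈ s, Real.exp (-a) := by
          refine Finset.prod_le_prod (fun _ _ => measureReal_nonneg) fun k hk => ?_
          rw [probReal_compl_eq_one_sub (hms _)]
          linarith [hAa k hk, Real.add_one_le_exp (-a)]
      _ = _ := by rw [Finset.prod_const, ← Real.exp_nat_mul]; ring_nf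
  -- Conditioning on the exact set of indices whose `A` occurs: it is a function of the `E`
  -- coordinates, hence independent of each `I k`. On a nonempty value `U`, the failure of `I k` for
  -- one fixed `k ∈ U` already costs at most `δ`.
  let K : (∀ i, α i) → Finset κ := fun y => s.filter fun k => y ∈ A k
  have hKdep : ∀ U : Finset κ, DependsOn (· ∈ {y | K y = U}) ((s.biUnion E : Finset ι) : Set ι) := by
    intro U y z hyz
    have : K y = K z := by
      refine Finset.filter_congr fun k hk => ?_
      exact (hA k hk fun e he => hyz e (by simp; exact ⟨k, hk, he⟩)).to_iff
    simp [this]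
  have hone : ∀ U ∈ s.powerset, P.real ({y | K y = U} ∩ {y | ∃ k ∈ s, y ∈ A k ∧ ∀ k ∈ U, y ∉ I k})
      ≤ P.real {y | K y = U} * δ := by
    intro U hU
    by_cases hne : U.Nonempty
    · obtain ⟨k, hk⟩ := hne
      have hks : k ∈ s := Finset.mem_powerset.1 hU hk
      calc _ ≤ P.real ({y | K y = U} ∩ (I k)ᶜ) := by
            refine measureReal_mono (fun y hy => ⟨hy.1, ?_⟩)
            obtain ⟨-, j, -, -, h⟩ := hy
            exact h k hk
        _ = P.real {y | K y = U} * P.real (I k)ᶜ := by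
            refine pi_inter_of_dependsOn μ ?_ (hKdep U) (compl _ _ (hI k hks))
            rw [Finset.disjoint_biUnion_left]
            exact fun j hj => hEF j hj k hks
        _ ≤ _ := by gcongr; exact hIδ k hks
    · rw [Finset.not_nonempty_iff_eq_empty] at hne
      subst hne
      refine le_trans (le_of_eq ?_) (mul_nonneg measureReal_nonneg hδ)
      convert measureReal_empty
      ext y
      simp only [Set.mem_inter_iff, Set.mem_ofPred_eq, Set.mem_empty_iff_false, iff_false, not_and]
      rintro hK ⟨k, hk, hkA, -⟩
      have : k ∈ K y := by simp [K, hk, hkA]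
      simp [hK] at this
  have hsub : {y | ∀ k ∈ s, y ∉ A k ∩ I k} ⊆ (⋂ k ∈ s, (A k)ᶜ) ∪
      ⋃ U ∈ s.powerset, ({y | K y = U} ∩ {y | ∃ k ∈ s, y ∈ A k ∧ ∀ k ∈ U, y ∉ I k}) := by
    intro y hy
    by_cases hc : ∃ k ∈ s, y ∈ A k
    · right
      simp only [Set.mem_iUnion]
      refine ⟨K y, by simp [K], rfl, ?_⟩
      obtain ⟨k, hk, hkA⟩ := hc
      refine ⟨k, hk, hkA, fun j hj hjI => ?_⟩
      simp only [K, Finset.mem_filter] at hj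
      exact hy j hj.1 ⟨hj.2, hjI⟩
    · left
      push Not at hc
      simpa using hc
  calc _ ≤ _ := measureReal_mono hsub
    _ ≤ _ := measureReal_union_le _ _
    _ ≤ Real.exp (-(a * s.card)) + ∑ U ∈ s.powerset, P.real {y | K y = U} * δ := by
        gcongr
        refine (measureReal_biUnion_finset_le _ _).trans (Finset.sum_le_sum hone)
    _ ≤ _ := by
        rw [← Finset.sum_mul]
        have : ∑ U ∈ s.powerset, P.real {y | K y = U} ≤ 1 := by
          rw [← measureReal_biUnion_finset]
          · exact measureReal_le_one
          · intro U _ V _ hUV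
            refine Set.disjoint_left.2 fun y hy hy' => hUV ?_
            simp only [Set.mem_ofPred_eq] at hy hy'
            rw [← hy, hy']
          · exact fun _ _ => hms _
        gcongr
        nlinarith

end Product

/-! ### Bayesian lower bound for the minimax error. -/

section Estimation

variable {n m : ℕ}

/-- The block vectors that represent the assignment `x` up to a global shift. -/
def orbit (x : Fin n → ZMod m) : Set (BlockVec n m) :=
  {z | ∃ l : ZMod m, z = shift l (vec x)}

/-- The letter at `i₀` reveals the shift, so a block vector in the orbit determines the normalized
assignment. -/
theorem orbit_disjoint (i₀ : Fin n) {x x' : Fin n → ZMod m} (hx : x i₀ = 0) (hx' : x' i₀ = 0)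
    (hne : x ≠ x') : Disjoint (orbit x) (orbit x') := by
  refine Set.disjoint_left.2 ?_
  rintro z ⟨l, hz⟩ ⟨l', hz'⟩
  have h : ∀ i, x i + l = x' i + l' := by
    intro i
    have h1 := congrFun (congrFun (hz.symm.trans hz') i) (x i + l)
    simp only [shift, vec, add_sub_cancel_right, Pi.single_eq_same] at h1
    by_contra hc
    rw [Pi.single_eq_of_ne (by intro h2; apply hc; rw [← h2]; ring)] at h1
    exact one_ne_zero h1
  have h0 := h i₀
  rw [hx, hx', zero_add, zero_add] at h0
  apply hne
  funext i
  have := h i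
  rw [h0] at this
  exact add_right_cancel this

/-- The probability mass function of the observation attached to a pair with difference `l`. -/
def sampleMass (p π₀ : ℝ) (l : ZMod m) : Sample m → ℝ
  | none => 1 - p
  | some v => p * ((1 - π₀) / m + if v = l then π₀ else 0)

theorem sampleMass_nonneg {p π₀ : ℝ} (hp : p ∈ Set.Icc (0 : ℝ) 1) (hπ : π₀ ∈ Set.Icc (0 : ℝ) 1)
    (l : ZMod m) (o : Sample m) : 0 ≤ sampleMass p π₀ l o := by
  have h1 := hπ.1
  have h2 := sub_nonneg.2 hπ.2
  have h3 := hp.1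
  cases o with
  | none => exact sub_nonneg.2 hp.2
  | some v => simp only [sampleMass]; split_ifs <;> positivity

variable [NeZero m]

theorem measurableSet_orbit (x : Fin n → ZMod m) : MeasurableSet (orbit x) := by
  have : (orbit x).Finite := by
    refine (Set.finite_range fun l : ZMod m => shift l (vec x)).subset ?_
    rintro z ⟨l, rfl⟩
    exact ⟨l, rfl⟩
  exact this.measurableSet

theorem MCR_pos_iff (hn : 0 < n) (z : BlockVec n m) (x : Fin n → ZMod m) :
    0 < MCR z (vec x) ↔ z ∉ orbit x := by
  have hn' : (0 : ℝ) < 1 / (n : ℝ) := by positivity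
  rw [MCR, mul_pos_iff_of_pos_left hn', Nat.cast_pos, Nat.pos_iff_ne_zero, not_iff_not]
  constructor
  · intro h
    obtain ⟨l, hl⟩ := Nat.sInf_mem
      (Set.range_nonempty fun l : ZMod m => blockSparsity (z - shift l (vec x)))
    refine ⟨l, ?_⟩
    have h0 : blockSparsity (z - shift l (vec x)) = 0 := hl.trans h
    rw [blockSparsity, Set.ncard_eq_zero (Set.toFinite _)] at h0
    funext i
    by_contra hne
    have : i ∈ {i | (z - shift l (vec x)) i ≠ 0} := by
      simpa [sub_eq_zero] using hne
    rw [h0] at this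
    exact this
  · rintro ⟨l, rfl⟩
    refine Nat.eq_zero_of_le_zero ((ciInf_le (OrderBot.bddBelow _) l).trans ?_)
    simp [blockSparsity]

variable {p π₀ : ℝ}

theorem measurementLaw_univ (hπ : π₀ ∈ Set.Icc (0 : ℝ) 1) (l : ZMod m) :
    measurementLaw π₀ l Set.univ = 1 := by
  simp [measurementLaw, ← ENNReal.ofReal_add hπ.1 (sub_nonneg.2 hπ.2)]

theorem isProbabilityMeasure_sampleLaw (hp : p ∈ Set.Icc (0 : ℝ) 1)
    (hπ : π₀ ∈ Set.Icc (0 : ℝ) 1) (l : ZMod m) : IsProbabilityMeasure (sampleLaw p π₀ l) := by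
  constructor
  rw [sampleLaw, Measure.add_apply, Measure.smul_apply, Measure.smul_apply,
    Measure.map_apply (measurable_of_finite _) .univ, Set.preimage_univ, measurementLaw_univ hπ]
  simp [← ENNReal.ofReal_add hp.1 (sub_nonneg.2 hp.2)]

instance : DiscreteMeasurableSpace (Sample m) := ⟨fun _ => trivial⟩

theorem sampleLaw_singleton (hp : p ∈ Set.Icc (0 : ℝ) 1) (hπ : π₀ ∈ Set.Icc (0 : ℝ) 1)
    (l : ZMod m) (o : Sample m) :
    sampleLaw p π₀ l {o} = ENNReal.ofReal (sampleMass p π₀ l o) := by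
  have h2 := sub_nonneg.2 hπ.2
  rw [sampleLaw, Measure.add_apply, Measure.smul_apply, Measure.smul_apply,
    Measure.map_apply (measurable_of_finite _) (measurableSet_singleton _)]
  cases o with
  | none =>
    have : (some ⁻¹' {(none : Sample m)} : Set (ZMod m)) = ∅ := by ext; simp
    simp [this, sampleMass]
  | some v =>
    have : (some ⁻¹' {(some v : Sample m)} : Set (ZMod m)) = {v} := by ext; simp
    have hm0 : (0 : ℝ) < m := Nat.cast_pos.2 (NeZero.pos m)
    rw [this, measurementLaw, Measure.add_apply, Measure.smul_apply, Measure.smul_apply,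
      PMF.toMeasure_apply_singleton _ _ (measurableSet_singleton _),
      PMF.uniformOfFintype_apply, ZMod.card, sampleMass, ENNReal.ofReal_mul hp.1,
      ENNReal.ofReal_add (by positivity) (by split_ifs; exacts [hπ.1, le_rfl]),
      ENNReal.ofReal_div_of_pos hm0]
    by_cases h : v = l
    · subst h; simp [ENNReal.div_eq_inv_mul, add_comm, mul_comm]
    · have h' : l ≠ v := Ne.symm h
      simp [h, h', ENNReal.div_eq_inv_mul, mul_comm]

theorem dataLaw_singleton (hp : p ∈ Set.Icc (0 : ℝ) 1) (hπ : π₀ ∈ Set.Icc (0 : ℝ) 1)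
    (x : Fin n → ZMod m) (y : Data n m) :
    dataLaw p π₀ x {y} =
      ENNReal.ofReal (∏ e : Pair n, sampleMass p π₀ (x e.1.1 - x e.1.2) (y e)) := by
  have := fun l : ZMod m => isProbabilityMeasure_sampleLaw hp hπ l
  rw [dataLaw, Measure.pi_singleton,
    ENNReal.ofReal_prod_of_nonneg fun e _ => sampleMass_nonneg hp hπ _ _]
  simp only [sampleLaw_singleton hp hπ]

theorem isProbabilityMeasure_dataLaw (hp : p ∈ Set.Icc (0 : ℝ) 1)
    (hπ : π₀ ∈ Set.Icc (0 : ℝ) 1) (x : Fin n → ZMod m) :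
    IsProbabilityMeasure (dataLaw p π₀ x) := by
  have := fun l : ZMod m => isProbabilityMeasure_sampleLaw hp hπ l
  rw [dataLaw]; infer_instance

theorem minimaxError_le_one (hp : p ∈ Set.Icc (0 : ℝ) 1)
    (hπ : π₀ ∈ Set.Icc (0 : ℝ) 1) : minimaxError n m p π₀ ≤ 1 := by
  refine (iInf₂_le (Kernel.const (Data n m) (Measure.dirac (0 : BlockVec n m)))
    (inferInstanceAs (IsMarkovKernel (Kernel.const _ _)))).trans (iSup_le fun x => ?_)
  have := isProbabilityMeasure_dataLaw hp hπ x
  calc _ ≤ ∫⁻ _, 1 ∂(dataLaw p π₀ x) := lintegral_mono fun y => prob_le_one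
    _ = 1 := by simp

/-- The average success probability over assignments normalized at `i₀` is bounded by the
total mass of any common upper bound of the likelihoods. -/
theorem card_le_card_mul_minimaxError_add (hp : p ∈ Set.Icc (0 : ℝ) 1)
    (hπ : π₀ ∈ Set.Icc (0 : ℝ) 1) (i₀ : Fin n) {F : Finset (Fin n → ZMod m)}
    (hF : ∀ x ∈ F, x i₀ = 0) {b : Data n m → ℝ≥0∞}
    (hb : ∀ x ∈ F, ∀ y, dataLaw p π₀ x {y} ≤ b y) :
    (F.card : ℝ≥0∞) ≤ F.card * minimaxError n m p π₀ + ∑ y, b y := by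
  classical
  by_cases hF0 : F.card = 0
  · simp [hF0]
  rw [minimaxError, ENNReal.mul_iInf_of_ne (by simpa using hF0) (by simp), ENNReal.iInf_add]
  refine le_iInf fun κ => ?_
  -- For a kernel that is not Markov the inner infimum is `⊤`, and its product with the nonzero
  -- cardinality is still `⊤`.
  by_cases hκ : IsMarkovKernel κ
  swap
  · simp [hκ, hF0, ENNReal.mul_top]
  simp only [hκ, iInf_pos]
  have hn : 0 < n := i₀.pos
  have hsplit : ∀ x ∈ F, errorProb p π₀ κ x + ∑ y, κ y (orbit x) * dataLaw p π₀ x {y} = 1 := by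
    intro x _
    have := isProbabilityMeasure_dataLaw hp hπ x
    rw [errorProb, lintegral_fintype, ← Finset.sum_add_distrib]
    calc _ = ∑ y, 1 * dataLaw p π₀ x {y} := by
          refine Finset.sum_congr rfl fun y _ => ?_
          rw [← add_mul]
          congr 1
          have : {z | 0 < MCR z (vec x)} = (orbit x)ᶜ := by
            ext z; exact MCR_pos_iff hn z x
          rw [this, add_comm]
          exact prob_add_prob_compl (measurableSet_orbit x)
      _ = ∫⁻ _, 1 ∂(dataLaw p π₀ x) := (lintegral_fintype _).symm
      _ = 1 := by simp
  calc (F.card : ℝ≥0∞)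
      = ∑ x ∈ F, (errorProb p π₀ κ x + ∑ y, κ y (orbit x) * dataLaw p π₀ x {y}) := by
        rw [Finset.sum_congr rfl hsplit]; simp
    _ ≤ ∑ x ∈ F, (⨆ x, errorProb p π₀ κ x) + ∑ x ∈ F, ∑ y, κ y (orbit x) * b y := by
        rw [Finset.sum_add_distrib]
        gcongr with x hx x hx y
        · exact le_iSup (fun x => errorProb p π₀ κ x) x
        · exact hb x hx y
    _ ≤ F.card * (⨆ x, errorProb p π₀ κ x) + ∑ y, b y := by
        rw [Finset.sum_const, nsmul_eq_mul, Finset.sum_comm]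
        gcongr with y
        -- Disjoint orbits share the unit mass of `κ y`.
        rw [← Finset.sum_mul, ← measure_biUnion_finset]
        · exact mul_le_of_le_one_left' prob_le_one
        · exact fun x hx x' hx' hne => orbit_disjoint i₀ (hF x hx) (hF x' hx') hne
        · exact fun x _ => measurableSet_orbit x

/-- If with probability at least `1 - ε` the true assignment is strictly less likely than some
other normalized assignment, then no estimator succeeds with probability more than `ε`. -/
theorem one_le_minimaxError_add (hp : p ∈ Set.Icc (0 : ℝ) 1)
    (hπ : π₀ ∈ Set.Icc (0 : ℝ) 1) (i₀ : Fin n) (G : (Fin n → ZMod m) → Set (Data n m))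
    (hG : ∀ x : Fin n → ZMod m, x i₀ = 0 → ∀ y ∉ G x, dataLaw p π₀ x {y} ≠ 0 →
      ∃ x' : Fin n → ZMod m, x' i₀ = 0 ∧ dataLaw p π₀ x {y} < dataLaw p π₀ x' {y})
    {ε : ℝ} (hε : ∀ x : Fin n → ZMod m, x i₀ = 0 → (dataLaw p π₀ x).real (G x) ≤ ε) :
    1 ≤ minimaxError n m p π₀ + ENNReal.ofReal ε := by
  classical
  set F : Finset (Fin n → ZMod m) := Finset.univ.filter fun x => x i₀ = 0
  have hF0 : (0 : Fin n → ZMod m) ∈ F := by simp [F]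
  have hcard : (F.card : ℝ≥0∞) ≠ 0 := by
    simpa using Finset.ne_empty_of_mem hF0
  have hprob := fun x : Fin n → ZMod m => isProbabilityMeasure_dataLaw hp hπ x
  have key := card_le_card_mul_minimaxError_add hp hπ i₀ (F := F) (by simp [F])
    (b := fun y => ∑ x ∈ F, (G x).indicator (fun y => dataLaw p π₀ x {y}) y) ?_
  · have hsum : ∑ y, ∑ x ∈ F, (G x).indicator (fun y => dataLaw p π₀ x {y}) y ≤
        F.card * ENNReal.ofReal ε := by
      rw [Finset.sum_comm, ← nsmul_eq_mul]
      refine Finset.sum_le_card_nsmul _ _ _ fun x hx => ?_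
      have hx0 : x i₀ = 0 := by simpa [F] using hx
      calc _ = ∑ y ∈ Finset.univ.filter (· ∈ G x), dataLaw p π₀ x {y} := by
            rw [Finset.sum_filter]
            simp [Set.indicator_apply]
        _ = dataLaw p π₀ x (G x) := by
            rw [sum_measure_singleton]; simp
        _ = ENNReal.ofReal ((dataLaw p π₀ x).real (G x)) := by simp
        _ ≤ _ := ENNReal.ofReal_le_ofReal (hε x hx0)
    have := key.trans (add_le_add_right hsum _)
    rw [← mul_add] at this
    rwa [← ENNReal.mul_le_mul_iff_right hcard (by simp), mul_one]
  · intro x hx y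
    -- A maximizer `w` of the likelihood has no strictly better competitor, so `y ∈ G w` unless its
    -- likelihood is zero; the single term at `w` then dominates every likelihood.
    obtain ⟨w, hw, hmax⟩ := F.exists_max_image (fun x => dataLaw p π₀ x {y}) ⟨x, hx⟩
    refine (hmax x hx).trans ?_
    by_cases h0 : dataLaw p π₀ w {y} = 0
    · simp [h0]
    have hwG : y ∈ G w := by
      by_contra hy
      obtain ⟨x', hx', hlt⟩ := hG w (by simpa [F] using hw) y hy h0
      exact absurd (hmax x' (by simpa [F] using hx')) (not_le.2 hlt)
    calc _ = (G w).indicator (fun y => dataLaw p π₀ w {y}) y := by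
          rw [Set.indicator_of_mem hwG]
      _ ≤ _ := Finset.single_le_sum
        (f := fun x => (G x).indicator (fun y => dataLaw p π₀ x {y}) y) (fun _ _ => zero_le) hw

/-- Without signal the data carry no information. -/
theorem one_le_minimaxError_zero_add (hm : 2 ≤ m) (hp : p ∈ Set.Icc (0 : ℝ) 1) (hn : 2 ≤ n) :
    1 ≤ minimaxError n m p 0 + ENNReal.ofReal (1 / (n - 1 : ℕ)) := by
  classical
  have : Fact (1 < m) := ⟨hm⟩
  have h01 : (0 : ℝ) ∈ Set.Icc (0 : ℝ) 1 := by simp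
  let i₀ : Fin n := ⟨0, by omega⟩
  -- These `n - 1` indistinguishable hypotheses suffice: the common likelihood has total mass 1, so
  -- the average success is at most `1 / (n - 1)`.
  set F : Finset (Fin n → ZMod m) :=
    (Finset.univ.erase i₀).image fun i => Pi.single i 1
  have hF : ∀ x ∈ F, x i₀ = 0 := by
    intro x hx
    obtain ⟨i, hi, rfl⟩ := Finset.mem_image.1 hx
    exact Pi.single_eq_of_ne (Finset.ne_of_mem_erase hi).symm _
  have hcard : F.card = n - 1 := by
    rw [Finset.card_image_of_injective, Finset.card_erase_of_mem (Finset.mem_univ _)]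
    · simp
    · intro i j hij
      by_contra hne
      have := congrFun hij i
      simp [Pi.single_eq_of_ne hne] at this
  have hprob := isProbabilityMeasure_dataLaw (n := n) (m := m) hp h01 0
  have key := card_le_card_mul_minimaxError_add hp h01 i₀ hF
    (b := fun y => dataLaw p 0 (0 : Fin n → ZMod m) {y}) (fun x _ y => by
      rw [dataLaw_singleton hp h01, dataLaw_singleton hp h01]
      refine le_of_eq (congrArg _ (Finset.prod_congr rfl fun e _ => ?_))
      cases y e <;> simp [sampleMass])
  rw [sum_measure_singleton, hcard] at key
  have hpos : (0 : ℝ) < (n - 1 : ℕ) := by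
    rw [Nat.cast_pos]; omega
  have hc0 : ((n - 1 : ℕ) : ℝ≥0∞) ≠ 0 := by
    rw [Nat.cast_ne_zero]; omega
  rw [← ENNReal.mul_le_mul_iff_right hc0 (by simp), mul_one, mul_add, ENNReal.ofReal_div_of_pos hpos,
    ENNReal.ofReal_natCast, ENNReal.ofReal_one, ENNReal.mul_div_cancel hc0 (by simp)]
  refine key.trans ?_
  gcongr
  exact prob_le_one

end Estimation

/-! ### Pairs meeting a given letter. -/

section Star

variable {n : ℕ}

/-- The pairs that join `i` to an element of `T`. -/
def star (i : Fin n) (T : Finset (Fin n)) : Finset (Pair n) :=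
  {e | (e.1.1 = i ∧ e.1.2 ∈ T) ∨ (e.1.2 = i ∧ e.1.1 ∈ T)}

theorem mem_star {i : Fin n} {T : Finset (Fin n)} {e : Pair n} :
    e ∈ star i T ↔ (e.1.1 = i ∧ e.1.2 ∈ T) ∨ (e.1.2 = i ∧ e.1.1 ∈ T) := by
  simp [star]

theorem card_star {i : Fin n} {T : Finset (Fin n)} (hi : i ∉ T) : (star i T).card = T.card := by
  symm
  refine Finset.card_bij (fun j hj => if h : j < i then ⟨(i, j), h⟩ else
    ⟨(j, i), lt_of_le_of_ne (not_lt.1 h) (by intro h'; exact hi (by rw [show i = j from h']; exact hj))⟩) ?_ ?_ ?_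
  · intro j hj
    rw [mem_star]
    split_ifs <;> simp [hj]
  · intro j hj k hk h
    have hji : j ≠ i := by rintro rfl; exact hi hj
    have hki : k ≠ i := by rintro rfl; exact hi hk
    split_ifs at h <;> simp_all
  · intro e he
    obtain ⟨⟨a, b⟩, hab⟩ := e
    rcases mem_star.1 he with ⟨h, hT⟩ | ⟨h, hT⟩
    · obtain rfl : a = i := h
      exact ⟨b, hT, by simp [hab]⟩
    · obtain rfl : b = i := h
      exact ⟨a, hT, by simp [not_lt_of_gt (show b < a from hab)]⟩

/-- A common pair either has the same centre in both stars and its other end in `T ∩ U`, or joins `i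
∈ U` to `j ∈ T`; the hypotheses exclude both. -/
theorem disjoint_star {i j : Fin n} {T U : Finset (Fin n)} (h : i ≠ j ∨ Disjoint T U)
    (hij : i ∉ U ∨ j ∉ T) (hi : i ∉ T) (hj : j ∉ U) : Disjoint (star i T) (star j U) := by
  rw [Finset.disjoint_left]
  intro e he he'
  rw [mem_star] at he he'
  have hTU : i = j → ∀ a ∈ T, a ∉ U := fun hij a ha ha' =>
    h.elim (fun h => h hij) fun h => Finset.disjoint_left.1 h ha ha'
  rcases he with ⟨rfl, hT⟩ | ⟨rfl, hT⟩ <;> rcases he' with ⟨rfl, hU⟩ | ⟨rfl, hU⟩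
  · exact hTU rfl _ hT hU
  · exact hij.elim (fun h => h hU) fun h => h hT
  · exact hij.elim (fun h => h hU) fun h => h hT
  · exact hTU rfl _ hT hU

end Star

/-! ### Likelihood ratios as lazy walks. -/

section Likelihood

variable {n m : ℕ}

/-- The score of an observation in favour of the difference `d'` against the difference `d`. -/
def score (d d' : ZMod m) (o : Sample m) : ℝ :=
  (if o = some d' then 1 else 0) - (if o = some d then 1 else 0)

/-- A sampled value has only two possible masses, so the ratio is a power -1, 0 or 1 of one
constant; `π₀ < 1` keeps that constant finite. -/
theorem sampleMass_eq_mul_exp [NeZero m] {p π₀ : ℝ} (h0 : 0 ≤ π₀) (h1 : π₀ < 1) (d d' : ZMod m)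
    (o : Sample m) :
    sampleMass p π₀ d' o = sampleMass p π₀ d o *
      Real.exp (Real.log (((1 - π₀) / m + π₀) / ((1 - π₀) / m)) * score d d' o) := by
  have hm : (0 : ℝ) < m := Nat.cast_pos.2 (NeZero.pos m)
  have hu : 0 < (1 - π₀) / m := div_pos (by linarith) hm
  have hv : 0 < (1 - π₀) / m + π₀ := by linarith
  cases o with
  | none => simp [sampleMass, score]
  | some v =>
    simp only [sampleMass, score, Option.some.injEq]
    by_cases hd : v = d <;> by_cases hd' : v = d'
    · simp [hd, ← hd']
    · rw [if_neg hd', if_pos hd, if_neg hd', if_pos hd, zero_sub, mul_neg_one, Real.exp_neg,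
        Real.exp_log (by positivity), add_zero]
      generalize (1 - π₀) / (m : ℝ) = u at *
      field_simp
    · rw [if_pos hd', if_neg hd, if_pos hd', if_neg hd, sub_zero, mul_one,
        Real.exp_log (by positivity), add_zero]
      generalize (1 - π₀) / (m : ℝ) = u at *
      field_simp
    · rw [if_neg hd', if_neg hd, if_neg hd', if_neg hd]; simp

/-- The score of the data in favour of the assignment `x'` against the assignment `x`,
restricted to the pairs in `T`. -/
def totalScore (x x' : Fin n → ZMod m) (T : Finset (Pair n)) (y : Data n m) : ℝ :=
  ∑ e ∈ T, score (x e.1.1 - x e.1.2) (x' e.1.1 - x' e.1.2) (y e)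

/-- The log-likelihood ratio is the total score times a constant that is positive because `π₀ > 0`.
Nonzero likelihood is required since `p = 1` gives mass zero to unsampled pairs. -/
theorem dataLaw_singleton_lt [NeZero m] {p π₀ : ℝ} (hp : p ∈ Set.Icc (0 : ℝ) 1) (h0 : 0 < π₀)
    (h1 : π₀ < 1) {x x' : Fin n → ZMod m} {y : Data n m}
    (hy : 0 < totalScore x x' Finset.univ y) (hx : dataLaw p π₀ x {y} ≠ 0) :
    dataLaw p π₀ x {y} < dataLaw p π₀ x' {y} := by
  have hπ : π₀ ∈ Set.Icc (0 : ℝ) 1 := ⟨h0.le, h1.le⟩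
  have hm : (0 : ℝ) < m := Nat.cast_pos.2 (NeZero.pos m)
  have hu : 0 < (1 - π₀) / m := div_pos (by linarith) hm
  rw [dataLaw_singleton hp hπ] at hx ⊢
  rw [dataLaw_singleton hp hπ x']
  have hpos := ENNReal.ofReal_pos.1 (pos_iff_ne_zero.2 hx)
  rw [ENNReal.ofReal_lt_ofReal_iff_of_nonneg hpos.le]
  simp_rw [fun e : Pair n => sampleMass_eq_mul_exp (p := p) h0.le h1 (x e.1.1 - x e.1.2)
    (x' e.1.1 - x' e.1.2) (y e)]
  rw [Finset.prod_mul_distrib, ← Real.exp_sum, ← Finset.mul_sum]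
  refine lt_mul_of_one_lt_right hpos (Real.one_lt_exp_iff.2 (mul_pos (Real.log_pos ?_) hy))
  rw [one_lt_div hu]
  linarith

/-- The scores of the perturbation of one letter are carried by the pairs containing it. -/
theorem totalScore_single (x : Fin n → ZMod m) {i : Fin n} {S : Finset (Fin n)} (hi : i ∈ S)
    (y : Data n m) :
    totalScore x (x + Pi.single i 1) Finset.univ y =
      totalScore x (x + Pi.single i 1) (star i Sᶜ) y +
      totalScore x (x + Pi.single i 1) (star i (S.erase i)) y := by
  classical
  rw [totalScore, totalScore, totalScore, ← Finset.sum_union]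
  · symm
    refine Finset.sum_subset (Finset.subset_univ _) fun e _ he => ?_
    have h1 : e.1.1 ≠ e.1.2 := e.2.ne'
    simp only [Finset.mem_union, mem_star, Finset.mem_compl, Finset.mem_erase] at he
    have : e.1.1 ≠ i ∧ e.1.2 ≠ i := by
      constructor
      · rintro rfl
        have := h1.symm
        tauto
      · rintro rfl
        tauto
    simp [Pi.single_eq_of_ne this.1, Pi.single_eq_of_ne this.2, score]
  · refine disjoint_star (.inr ?_) (.inl (by simp)) (by simpa) (by simp)
    rw [Finset.disjoint_left]
    intro a ha ha'
    simp_all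

variable [NeZero m] {p π₀ : ℝ}

/-- The law of the score is the same for all distinct `d`, `d'`, so every pair at a changed letter
contributes an identical walk step. -/
theorem integral_score (hp : p ∈ Set.Icc (0 : ℝ) 1) (hπ : π₀ ∈ Set.Icc (0 : ℝ) 1)
    {d d' : ZMod m} (hd : d ≠ d') (g : ℝ → ℝ) :
    ∫ o, g (score d d' o) ∂(sampleLaw p π₀ d) =
      p * ((1 - π₀) / m) * g 1 + p * ((1 - π₀) / m + π₀) * g (-1) +
        (1 - p * ((1 - π₀) / m) - p * ((1 - π₀) / m + π₀)) * g 0 := by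
  have := isProbabilityMeasure_sampleLaw hp hπ d
  have hm : (m : ℝ) ≠ 0 := Nat.cast_ne_zero.2 (NeZero.ne m)
  rw [integral_fintype .of_finite]
  simp only [measureReal_def, sampleLaw_singleton hp hπ,
    ENNReal.toReal_ofReal (sampleMass_nonneg hp hπ _ _), smul_eq_mul, Fintype.sum_option]
  have hs : ∀ v : ZMod m, sampleMass p π₀ d (some v) * g (score d d' (some v)) =
      p * ((1 - π₀) / m) * g 0 +
      (if v = d' then p * ((1 - π₀) / m) * (g 1 - g 0) else 0) +
      (if v = d then p * ((1 - π₀) / m + π₀) * g (-1) - p * ((1 - π₀) / m) * g 0 else 0) := by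
    intro v
    simp only [sampleMass, score, Option.some.injEq]
    by_cases h : v = d
    · subst h; simp [hd]
    · by_cases h' : v = d'
      · subst h'; simp [h]; ring
      · simp [h, h']
  simp only [hs, Finset.sum_add_distrib, Finset.sum_ite_eq', Finset.mem_univ, if_true,
    Finset.sum_const, Finset.card_univ, ZMod.card, nsmul_eq_mul]
  simp only [sampleMass, score]
  field_simp
  simp
  ring

theorem iIndepFun_score (hp : p ∈ Set.Icc (0 : ℝ) 1) (hπ : π₀ ∈ Set.Icc (0 : ℝ) 1)
    (x : Fin n → ZMod m) (d d' : Pair n → ZMod m) :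
    iIndepFun (fun (e : Pair n) (y : Data n m) => score (d e) (d' e) (y e)) (dataLaw p π₀ x) := by
  have hprob := fun l : ZMod m => isProbabilityMeasure_sampleLaw hp hπ l
  rw [dataLaw]
  exact iIndepFun_pi (μ := fun e : Pair n => sampleLaw p π₀ (x e.1.1 - x e.1.2))
    (X := fun (e : Pair n) (o : Sample m) => score (d e) (d' e) o)
    fun e => (measurable_of_finite _).aemeasurable

theorem integral_dataLaw (hp : p ∈ Set.Icc (0 : ℝ) 1) (hπ : π₀ ∈ Set.Icc (0 : ℝ) 1)
    (x : Fin n → ZMod m) (e : Pair n) (g : Sample m → ℝ) :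
    ∫ y, g (y e) ∂(dataLaw p π₀ x) = ∫ o, g o ∂(sampleLaw p π₀ (x e.1.1 - x e.1.2)) := by
  have hprob := fun l : ZMod m => isProbabilityMeasure_sampleLaw hp hπ l
  have hmp : MeasurePreserving (Function.eval e) (dataLaw p π₀ x)
      (sampleLaw p π₀ (x e.1.1 - x e.1.2)) :=
    measurePreserving_eval (fun e : Pair n => sampleLaw p π₀ (x e.1.1 - x e.1.2)) e
  rw [← hmp.map_eq, integral_map hmp.measurable.aemeasurable
    (measurable_of_finite _).aestronglyMeasurable]

/-- The probability that no perturbation of a single letter in `S` is more likely than the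
true assignment. -/
theorem dataLaw_totalScore_le (hm : 2 ≤ m) (hp : p ∈ Set.Icc (0 : ℝ) 1)
    (hπ : π₀ ∈ Set.Icc (0 : ℝ) 1) (x : Fin n → ZMod m) (S : Finset (Fin n))
    {q r t h h' M μ : ℝ} (hq : q = p * ((1 - π₀) / m)) (hr : r = p * ((1 - π₀) / m + π₀))
    (ht : 0 ≤ t) (hh : 0 < h)
    (hM : M = 1 - q - r + q * Real.exp t + r * Real.exp (-t)) (hM0 : 0 < M)
    (hμ : μ * M = q * Real.exp t - r * Real.exp (-t))
    (hh' : 0 < h') (hh'2 : h' ≤ (Sᶜ.card : ℝ) * μ - h - S.card * (r - q)) :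
    (dataLaw p π₀ x).real {y | ∀ i ∈ S, totalScore x (x + Pi.single i 1) Finset.univ y ≤ 0} ≤
      Real.exp (-(M ^ Sᶜ.card *
        (1 - Sᶜ.card * ((q * Real.exp t + r * Real.exp (-t)) / M) / h ^ 2) *
        Real.exp (-(t * (Sᶜ.card * μ + h))) * S.card)) + S.card * (q + r) / h' ^ 2 := by
  classical
  have : Fact (1 < m) := ⟨hm⟩
  have hprob := fun l : ZMod m => isProbabilityMeasure_sampleLaw hp hπ l
  have hπ2 := sub_nonneg.2 hπ.2
  have hp1 := hp.1
  have hπ1 := hπ.1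
  have hq0 : 0 ≤ q := by rw [hq]; positivity
  have hr0 : 0 ≤ r := by rw [hr]; positivity
  have hrq : q ≤ r := by rw [hq, hr]; gcongr; linarith
  have hdata := isProbabilityMeasure_dataLaw hp hπ x
  have hX : ∀ i, iIndepFun (fun (e : Pair n) (y : Data n m) =>
      score (x e.1.1 - x e.1.2)
        ((x + Pi.single i 1 : Fin n → ZMod m) e.1.1 - (x + Pi.single i 1 : Fin n → ZMod m) e.1.2)
        (y e)) (dataLaw p π₀ x) := by
    intro i
    exact iIndepFun_score hp hπ x _ _
  have hlaw : ∀ i, ∀ T : Finset (Fin n), i ∉ T → ∀ e ∈ star i T, ∀ g : ℝ → ℝ,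
      ∫ y, g (score (x e.1.1 - x e.1.2)
        ((x + Pi.single i 1 : Fin n → ZMod m) e.1.1 - (x + Pi.single i 1 : Fin n → ZMod m) e.1.2)
        (y e)) ∂(dataLaw p π₀ x) = q * g 1 + r * g (-1) + (1 - q - r) * g 0 := by
    intro i T hiT e he g
    have hne : x e.1.1 - x e.1.2 ≠
        (x + Pi.single i 1 : Fin n → ZMod m) e.1.1 - (x + Pi.single i 1 : Fin n → ZMod m) e.1.2 := by
      rcases mem_star.1 he with ⟨h1, h2⟩ | ⟨h1, h2⟩
      · have h3 : e.1.2 ≠ i := by rintro h3; exact hiT (h3 ▸ h2)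
        simp only [Pi.add_apply, h1, Pi.single_eq_same, Pi.single_eq_of_ne h3]
        intro hc
        have : (1 : ZMod m) = 0 := by linear_combination -hc
        exact one_ne_zero this
      · have h3 : e.1.1 ≠ i := by rintro h3; exact hiT (h3 ▸ h2)
        simp only [Pi.add_apply, h1, Pi.single_eq_same, Pi.single_eq_of_ne h3]
        intro hc
        have : (1 : ZMod m) = 0 := by linear_combination hc
        exact one_ne_zero this
    rw [hq, hr, ← integral_score hp hπ hne g]
    exact integral_dataLaw hp hπ x e fun o => g (score _ _ o)
  have hdep : ∀ i, ∀ T : Finset (Pair n), ∀ B : Set ℝ,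
      DependsOn (· ∈ {y | totalScore x (x + Pi.single i 1) T y ∈ B}) (T : Set (Pair n)) := by
    intro i T B y z hyz
    have : totalScore x (x + Pi.single i 1) T y = totalScore x (x + Pi.single i 1) T z :=
      Finset.sum_congr rfl fun e he => by rw [hyz e he]
    simp [this]
  have hout : ∀ i ∈ S, (star i Sᶜ).card = Sᶜ.card := fun i hi => card_star (by simpa)
  refine (measureReal_mono ?_).trans (pi_forall_notMem_inter_le
    (fun e : Pair n => sampleLaw p π₀ (x e.1.1 - x e.1.2)) S
    (E := fun i => star i Sᶜ) (F := fun i => star i (S.erase i))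
    (A := fun i => {y | totalScore x (x + Pi.single i 1) (star i Sᶜ) y ∈ Set.Ici (Sᶜ.card * μ - h)})
    (I := fun i => {y | totalScore x (x + Pi.single i 1) (star i (S.erase i)) y ∈
      Set.Ioi (-(Sᶜ.card * μ - h))})
    ?_ ?_ (fun i _ => hdep _ _ _) (fun i _ => hdep _ _ _) (fun i hi => ?_) (fun i hi => ?_) ?_)
  · intro y hy i hi hmem
    have h1 := hy i hi
    rw [totalScore_single x hi] at h1
    have h2 := hmem.1
    have h3 := hmem.2
    simp only [Set.mem_ofPred_eq, Set.mem_Ici, Set.mem_Ioi] at h2 h3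
    linarith
  · intro i hi j hj hij
    exact disjoint_star (.inl hij) (.inl (by simpa using hi)) (by simpa using hi) (by simpa using hj)
  · intro i hi j hj
    by_cases hij : i = j
    · subst hij
      refine disjoint_star (.inr ?_) (.inl (by simp)) (by simpa) (by simp)
      rw [Finset.disjoint_left]
      intro a ha ha'
      simp_all
    · exact disjoint_star (.inl hij) (.inr (by simpa)) (by simpa) (by simp)
  · have := le_measureReal_walk (hX i) ht hh (hlaw i Sᶜ (by simpa)) hM hM0 hμ
    rw [hout i hi] at this
    exact this
  · have hk : (((star i (S.erase i)).card : ℕ) : ℝ) ≤ S.card := by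
      rw [card_star (by simp)]
      exact_mod_cast Finset.card_le_card (Finset.erase_subset _ _)
    set k : ℝ := (((star i (S.erase i)).card : ℕ) : ℝ)
    have hk0 : 0 ≤ k := Nat.cast_nonneg _
    -- The inner walk has at most `S.card` steps, each with drift `q - r ≤ 0`.
    have hge : h' ≤ (Sᶜ.card : ℝ) * μ - h + k * (q - r) := by nlinarith
    have h1 := measureReal_walk_le (hX i) (lt_of_lt_of_le hh' hge)
      (hlaw i (S.erase i) (by simp))
    refine le_trans (le_of_eq ?_) (h1.trans ?_)
    · change (dataLaw p π₀ x).real _ = _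
      congr 1
      ext y
      simp only [Set.mem_compl_iff, Set.mem_ofPred_eq, Set.mem_Ioi, not_lt, totalScore, k]
      constructor <;> intro h <;> linarith
    · gcongr
  · positivity

end Likelihood

/-! ### Choice of the tilting parameter. -/

section Parameters

theorem exp_mul_one_sub_le (a : ℝ) : Real.exp a * (1 - a) ≤ 1 := by
  calc _ ≤ Real.exp a * Real.exp (-a) := by
        gcongr; linarith [Real.add_one_le_exp (-a)]
    _ = 1 := by rw [← Real.exp_add]; simp

theorem exp_sub_exp_neg_le {a : ℝ} (h0 : 0 ≤ a) (h1 : a ≤ 1 / 2) :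
    Real.exp a - Real.exp (-a) ≤ 4 * a := by
  have h2 := exp_mul_one_sub_le a
  have h3 := Real.add_one_le_exp (-a)
  nlinarith

theorem exp_add_exp_neg_le {a : ℝ} (h0 : 0 ≤ a) (h1 : a ≤ 1 / 2) :
    Real.exp a + Real.exp (-a) ≤ 3 := by
  have h2 := exp_mul_one_sub_le a
  have h3 : Real.exp (-a) ≤ 1 := Real.exp_le_one_iff.2 (by linarith)
  nlinarith [Real.exp_pos a]

/-- Factor `r - q` as a difference of squares and use `√r + √q ≥ 2 √q`. -/
theorem sqrt_sub_sqrt_sq_mul_le {q r : ℝ} (hq : 0 ≤ q) (hqr : q ≤ r) :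
    (√r - √q) ^ 2 * (4 * q) ≤ (r - q) ^ 2 := by
  have h1 := Real.sq_sqrt hq
  have h2 := Real.sq_sqrt (hq.trans hqr)
  have h3 : √q ≤ √r := Real.sqrt_le_sqrt hqr
  have h4 := Real.sqrt_nonneg q
  calc (√r - √q) ^ 2 * (4 * q) = (√r - √q) ^ 2 * (√q + √q) ^ 2 := by linear_combination (-4 * (√r - √q) ^ 2) * h1
    _ ≤ (√r - √q) ^ 2 * (√r + √q) ^ 2 := by gcongr
    _ = (√r ^ 2 - √q ^ 2) ^ 2 := by ring
    _ = _ := by rw [h1, h2]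

theorem exp_neg_div_le_pow {X : ℝ} (h1 : X < 1) (N : ℕ) :
    Real.exp (-(N * (X / (1 - X)))) ≤ (1 - X) ^ N := by
  have h : Real.exp (-(X / (1 - X))) ≤ 1 - X := by
    rw [Real.exp_neg]
    refine inv_le_of_inv_le₀ (by linarith) ?_
    refine le_trans (le_of_eq ?_) (Real.add_one_le_exp _)
    have : 1 - X ≠ 0 := by linarith
    field_simp; ring
  calc _ = Real.exp (-(X / (1 - X))) ^ N := by rw [← Real.exp_nat_mul]; ring_nf
    _ ≤ _ := by gcongr

set_option maxHeartbeats 1000000 in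
/-- The choice of the tilting parameter, together with the resulting lower bound for the
probability that a walk with slightly negative drift ends above the level `n p η w / (8 m)`. -/
theorem exists_tilt {N : ℕ} {n m p π θ β η w L q r : ℝ} (hm : 2 ≤ m) (hn : 0 < n)
    (hN1 : n / 2 ≤ N) (hN2 : N ≤ n) (hp0 : 0 < p) (hp1 : p ≤ 1) (hπ0 : 0 ≤ π)
    (hθ0 : 0 < θ) (hθ1 : θ < 1) (hβ : β = (1 - θ) / 8) (hη : η = β / (12 * (1 + 2 * m)))
    (hw0 : 0 < w) (hw : 4 * w ≤ β) (hnpw : n * p * w ^ 2 = L) (hπw : m * π ^ 2 ≤ 4 * θ * w ^ 2)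
    (hL : 768 * m ^ 2 / η ^ 2 ≤ L)
    (hq : q = p * ((1 - π) / m)) (hr : r = p * ((1 - π) / m + π)) :
    ∃ t M μ h : ℝ, 0 ≤ t ∧ 0 < h ∧ M = 1 - q - r + q * Real.exp t + r * Real.exp (-t) ∧ 0 < M ∧
      μ * M = q * Real.exp t - r * Real.exp (-t) ∧
      n * p * η * w / (8 * m) ≤ N * μ - h ∧
      1 / 2 * Real.exp (-((θ + 3 * β) * L)) ≤
        M ^ N * (1 - N * ((q * Real.exp t + r * Real.exp (-t)) / M) / h ^ 2) *
        Real.exp (-(t * (N * μ + h))) := by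
  have hβ0 : 0 < β := by rw [hβ]; linarith
  have hβ1 : β ≤ 1 / 8 := by rw [hβ]; linarith
  have hη0 : 0 < η := by rw [hη]; positivity
  have hη1 : η ≤ 1 := by
    rw [hη, div_le_one (by positivity)]; linarith
  have hηm : 12 * η * (η + 2 * m) ≤ β := by
    have : 12 * η * (1 + 2 * m) = β := by rw [hη]; field_simp
    nlinarith
  have hL0 : 0 < L := by rw [← hnpw]; positivity
  have hπ2w : π ≤ 2 * w := by
    refine abs_le_of_sq_le_sq' ?_ (by linarith) |>.2
    nlinarith [sq_nonneg π, sq_nonneg w]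
  have hπh : π ≤ 1 / 2 := by linarith
  have hm0 : 0 < m := by linarith
  have hq1 : p / (2 * m) ≤ q := by
    rw [hq]
    calc p / (2 * m) = p * ((1 / 2) / m) := by field_simp
      _ ≤ _ := by gcongr; linarith
  have hq0 : 0 < q := lt_of_lt_of_le (by positivity) hq1
  have hrq : r = q + p * π := by rw [hr, hq]; ring
  have hqr : q ≤ r := by rw [hrq]; nlinarith
  have hr0 : 0 < r := by linarith
  have hrp : r ≤ p := by
    have : (1 - π) / m ≤ 1 - π := div_le_self (by linarith) (by linarith)
    rw [hr]
    calc _ ≤ p * 1 := by gcongr; linarith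
      _ = p := mul_one p
  -- The tilt is `a + log (r / q) / 2`. The logarithm balances both step weights at `g = √(q r)`,
  -- which minimizes the moment generating function; the small excess `a` makes the tilted drift
  -- positive.
  obtain ⟨a, ha⟩ : ∃ a, a = η * w := ⟨_, rfl⟩
  have ha0 : 0 < a := by rw [ha]; positivity
  have ha1 : a ≤ 1 / 2 := by
    have : η * w ≤ 1 * w := by gcongr
    rw [ha]; linarith
  obtain ⟨g, hg⟩ : ∃ g, g = √q * √r := ⟨_, rfl⟩
  have hsq := Real.sq_sqrt hq0.le
  have hsr := Real.sq_sqrt hr0.le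
  have hsq0 := Real.sqrt_pos.2 hq0
  have hsr0 := Real.sqrt_pos.2 hr0
  have hsqr : √q ≤ √r := Real.sqrt_le_sqrt hqr
  have hgq : q ≤ g := by
    calc q = √q * √q := by rw [← sq, hsq]
      _ ≤ g := by rw [hg]; gcongr
  have hgr : g ≤ r := by
    calc g ≤ √r * √r := by rw [hg]; gcongr
      _ = r := by rw [← sq, hsr]
  have hg0 : 0 < g := by linarith
  have ht1 : q * Real.exp (a + Real.log (r / q) / 2) = g * Real.exp a := by
    rw [Real.exp_add, ← Real.log_sqrt (by positivity), Real.exp_log (by positivity),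
      Real.sqrt_div hr0.le, hg]
    field_simp
    rw [hsq]
  have ht2 : r * Real.exp (-(a + Real.log (r / q) / 2)) = g * Real.exp (-a) := by
    rw [neg_add, Real.exp_add, Real.exp_neg (Real.log (r / q) / 2),
      ← Real.log_sqrt (by positivity), Real.exp_log (by positivity), Real.sqrt_div hr0.le, hg]
    field_simp
    rw [hsr]
  have ht0 : 0 ≤ a + Real.log (r / q) / 2 := by
    have := Real.log_nonneg ((one_le_div hq0).2 hqr)
    positivity
  have htw : a + Real.log (r / q) / 2 ≤ (η + 2 * m) * w := by
    have h1 : Real.log (r / q) ≤ r / q - 1 := Real.log_le_sub_one_of_pos (by positivity)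
    have h2 : r / q - 1 ≤ 2 * m * π := by
      rw [tsub_le_iff_right, div_le_iff₀ hq0, hrq]
      have h4 : p ≤ q * (2 * m) := (div_le_iff₀ (by positivity)).1 hq1
      calc q + p * π ≤ q + q * (2 * m) * π := by gcongr
        _ = _ := by ring
    have h3 : m * π ≤ m * (2 * w) := by gcongr
    rw [ha]; linarith
  obtain ⟨t, ht⟩ : ∃ t, t = a + Real.log (r / q) / 2 := ⟨_, rfl⟩
  rw [← ht] at ht0 ht1 ht2 htw
  -- `1 - X` is the minimum of the moment generating function, so `X` sets the large-deviation cost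
  -- of each step.
  obtain ⟨X, hX⟩ : ∃ X, X = (√r - √q) ^ 2 := ⟨_, rfl⟩
  have hX0 : 0 ≤ X := by rw [hX]; positivity
  have hXg : X = q + r - 2 * g := by rw [hX, hg]; linear_combination hsq + hsr
  have hXq : X * (1 - π) ≤ p * (θ * w ^ 2) := by
    have h2 : X * (4 * q) ≤ (p * π) ^ 2 := by
      rw [show p * π = r - q by linarith, hX]
      exact sqrt_sub_sqrt_sq_mul_le hq0.le hqr
    have h3 : q * m = p * (1 - π) := by rw [hq]; field_simp
    have h4 : 4 * p * (X * (1 - π)) ≤ 4 * p * (p * (θ * w ^ 2)) := by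
      calc 4 * p * (X * (1 - π)) = X * (4 * q) * m := by linear_combination -4 * X * h3
        _ ≤ (p * π) ^ 2 * m := by gcongr
        _ = p ^ 2 * (m * π ^ 2) := by ring
        _ ≤ p ^ 2 * (4 * θ * w ^ 2) := by gcongr
        _ = _ := by ring
    exact le_of_mul_le_mul_left h4 (by positivity)
  have hX1 : X ≤ 2 * w := by
    have h1 : p * (θ * w ^ 2) ≤ w ^ 2 := by
      calc p * (θ * w ^ 2) ≤ 1 * (1 * w ^ 2) := by gcongr
        _ = w ^ 2 := by ring
    have h2 : X * (1 / 2) ≤ X * (1 - π) := by gcongr; linarith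
    have h3 : w ^ 2 ≤ w * 1 := by rw [sq]; gcongr; linarith
    linarith
  -- Both `π` and `X` are at most `2 w`; this is where `4 w ≤ β` enters.
  have hXπ : 1 - β ≤ (1 - π) * (1 - X) := by
    have : 0 ≤ π * X := by positivity
    linarith
  have hXh : X ≤ 1 / 2 := by linarith
  obtain ⟨C, hC⟩ : ∃ C, C = Real.exp a + Real.exp (-a) := ⟨_, rfl⟩
  have hC2 : 2 ≤ C := by
    have h1 := Real.add_one_le_exp a
    have h2 := Real.add_one_le_exp (-a)
    linarith
  have hsh := exp_sub_exp_neg_le ha0.le ha1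
  have hsh2 : 2 * a ≤ Real.exp a - Real.exp (-a) := by
    have := Real.self_le_sinh_iff.2 ha0.le
    rw [Real.sinh_eq] at this; linarith
  have hC3 : C ≤ 3 := hC ▸ exp_add_exp_neg_le ha0.le ha1
  obtain ⟨M, hM⟩ : ∃ M, M = 1 - q - r + q * Real.exp t + r * Real.exp (-t) := ⟨_, rfl⟩
  have hM' : M = 1 - X + g * (C - 2) := by
    rw [hM, ht1, ht2, hXg, hC]; ring
  have hMX : 1 - X ≤ M := by
    have : 0 ≤ g * (C - 2) := mul_nonneg hg0.le (by linarith)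
    linarith
  have hM2 : M ≤ 2 := by
    have : g * (C - 2) ≤ 1 * 1 := by gcongr <;> linarith
    linarith
  have hMh : 1 / 2 ≤ M := by linarith
  have hM0 : 0 < M := by linarith
  obtain ⟨μ, hμ⟩ : ∃ μ, μ = (g * (Real.exp a - Real.exp (-a))) / M := ⟨_, rfl⟩
  have hμM : μ * M = g * (Real.exp a - Real.exp (-a)) := by rw [hμ]; field_simp
  have hN0 : (0 : ℝ) < N := by linarith
  have hμ1 : p * a / (2 * m) ≤ μ := by
    have h1 : p / (2 * m) * (2 * a) ≤ g * (Real.exp a - Real.exp (-a)) := by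
      gcongr; linarith
    have h2 : p / (2 * m) * (2 * a) = p * a / (2 * m) * 2 := by ring
    have h3 : 0 < p * a / (2 * m) := by positivity
    have h4 : p * a / (2 * m) * M ≤ p * a / (2 * m) * 2 := by gcongr
    rw [hμ, le_div_iff₀ hM0]
    linarith
  have hμ2 : μ ≤ 8 * p * a := by
    rw [hμ, div_le_iff₀ hM0]
    have h1 : g ≤ p := hgr.trans hrp
    have h2 : 0 ≤ Real.exp a - Real.exp (-a) := by linarith
    calc _ ≤ p * (4 * a) := by gcongr
      _ = 8 * p * a * (1 / 2) := by ring
      _ ≤ _ := by gcongr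
  have hμ0 : 0 < μ := lt_of_lt_of_le (by positivity) hμ1
  have hNμ1 : n * p * η * w / (4 * m) ≤ N * μ := by
    calc n * p * η * w / (4 * m) = n / 2 * (p * a / (2 * m)) := by rw [ha]; ring
      _ ≤ _ := by gcongr
  have hNμ2 : N * μ ≤ 8 * n * p * η * w := by
    calc N * μ ≤ n * (8 * p * a) := by gcongr
      _ = _ := by rw [ha]; ring
  have hh1 : n * p * η * w / (8 * m) ≤ N * μ / 2 := by
    have : n * p * η * w / (8 * m) = n * p * η * w / (4 * m) / 2 := by ring
    linarith
  -- Half the tilted mean as deviation leaves a level of order `n p η w`, while `h` exceeds the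
  -- standard deviation, of order `√(n p)`, by a factor of order `η √L`.
  refine ⟨t, M, μ, N * μ / 2, ht0, by positivity, hM, hM0, ?_, by linarith, ?_⟩
  · rw [hμM, ht1, ht2]; ring
  have e1 : Real.exp (-((θ + 2 * β) * L)) ≤ M ^ N := by
    calc _ ≤ Real.exp (-(N * (X / (1 - X)))) := by
          refine Real.exp_le_exp.2 (neg_le_neg ?_)
          calc N * (X / (1 - X)) ≤ n * (X / (1 - X)) := by
                have : 0 ≤ X / (1 - X) := div_nonneg hX0 (by linarith)
                gcongr
            _ ≤ _ := by
                rw [← mul_div_assoc, div_le_iff₀ (by linarith)]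
                have h1 : n * X * (1 - π) ≤ θ * L := by
                  calc n * X * (1 - π) = n * (X * (1 - π)) := by ring
                    _ ≤ n * (p * (θ * w ^ 2)) := by gcongr
                    _ = _ := by rw [← hnpw]; ring
                have h2 : θ * L ≤ (θ + 2 * β) * L * (1 - β) := by
                  have : θ ≤ (θ + 2 * β) * (1 - β) := by
                    have : 0 ≤ β * (2 - θ - 2 * β) := mul_nonneg hβ0.le (by linarith)
                    linarith
                  calc θ * L ≤ (θ + 2 * β) * (1 - β) * L := by gcongr
                    _ = _ := by ring
                have h3 : (θ + 2 * β) * L * (1 - β) ≤ (θ + 2 * β) * L * ((1 - π) * (1 - X)) := by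
                  gcongr
                have h4 : n * X * (1 - π) ≤ (θ + 2 * β) * L * (1 - X) * (1 - π) := by linarith
                exact le_of_mul_le_mul_right h4 (by linarith)
      _ ≤ (1 - X) ^ N := exp_neg_div_le_pow (by linarith) N
      _ ≤ M ^ N := by gcongr; linarith
  have e2 : 1 / 2 ≤ 1 - N * ((q * Real.exp t + r * Real.exp (-t)) / M) / (N * μ / 2) ^ 2 := by
    have h1 : (q * Real.exp t + r * Real.exp (-t)) / M ≤ 6 * p := by
      rw [ht1, ht2, ← mul_add, ← hC, div_le_iff₀ hM0]
      calc g * C ≤ p * 3 := by gcongr; linarith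
        _ = 6 * p * (1 / 2) := by ring
        _ ≤ _ := by gcongr
    have h2 : N * ((q * Real.exp t + r * Real.exp (-t)) / M) / (N * μ / 2) ^ 2 ≤
        n * (6 * p) / (n * p * η * w / (8 * m)) ^ 2 := by
      gcongr
    have h3 : n * (6 * p) / (n * p * η * w / (8 * m)) ^ 2 = 384 * m ^ 2 / η ^ 2 / L := by
      rw [← hnpw]; field_simp; norm_num
    have h4 : 384 * m ^ 2 / η ^ 2 / L ≤ 1 / 2 := by
      rw [div_le_iff₀ hL0]
      have : 768 * m ^ 2 / η ^ 2 = 2 * (384 * m ^ 2 / η ^ 2) := by ring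
      linarith
    linarith
  -- Reaching the upper end `3 N μ / 2` costs `O(η L)` in the exponent; `η` was chosen so that this
  -- is at most `β L`.
  have e3 : Real.exp (-(β * L)) ≤ Real.exp (-(t * (N * μ + N * μ / 2))) := by
    refine Real.exp_le_exp.2 (neg_le_neg ?_)
    calc t * (N * μ + N * μ / 2) = t * (3 / 2 * (N * μ)) := by ring
      _ ≤ ((η + 2 * m) * w) * (3 / 2 * (8 * n * p * η * w)) := by gcongr
      _ = 12 * η * (η + 2 * m) * L := by rw [← hnpw]; ring
      _ ≤ β * L := by gcongr
  calc 1 / 2 * Real.exp (-((θ + 3 * β) * L))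
      = Real.exp (-((θ + 2 * β) * L)) * (1 / 2) * Real.exp (-(β * L)) := by
        rw [show -((θ + 3 * β) * L) = -((θ + 2 * β) * L) + -(β * L) by ring, Real.exp_add]; ring
    _ ≤ _ := by gcongr

end Parameters

/-! ### Quantitative converse and its limit. -/

section Minimax

variable {m : ℕ}

/-- The bound on the probability of exact recovery. -/
def recoveryBound (m : ℕ) (β η : ℝ) (n : ℕ) : ℝ :=
  Real.exp (-(η / (128 * m) * Real.exp (5 * β * Real.log n))) +
    512 * m ^ 2 / (η ^ 2 * Real.log n)

theorem tendsto_recoveryBound (hm : 0 < m) {β η : ℝ} (hβ : 0 < β) (hη : 0 < η) :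
    Tendsto (recoveryBound m β η) atTop (𝓝 0) := by
  have hlog : Tendsto (fun n : ℕ => Real.log n) atTop atTop :=
    Real.tendsto_log_atTop.comp tendsto_natCast_atTop_atTop
  have hm' : (0 : ℝ) < m := Nat.cast_pos.2 hm
  have h1 : Tendsto (fun n : ℕ => Real.exp (-(η / (128 * m) * Real.exp (5 * β * Real.log n))))
      atTop (𝓝 0) := by
    refine Real.tendsto_exp_neg_atTop_nhds_zero.comp (Tendsto.const_mul_atTop (by positivity) ?_)
    exact Real.tendsto_exp_atTop.comp (hlog.const_mul_atTop (by positivity))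
  have h2 : Tendsto (fun n : ℕ => 512 * (m : ℝ) ^ 2 / (η ^ 2 * Real.log n)) atTop (𝓝 0) :=
    tendsto_const_nhds.div_atTop (hlog.const_mul_atTop (by positivity))
  have h3 := h1.add h2
  rw [add_zero] at h3
  exact h3

variable [NeZero m]

/-- The quantitative converse at a fixed, large number of vertices. -/
theorem one_le_minimaxError_add_recoveryBound (hm : 2 ≤ m) {n : ℕ} {p π₀ θ β η w : ℝ}
    (hθ0 : 0 < θ) (hθ1 : θ < 1) (hβ : β = (1 - θ) / 8) (hη : η = β / (12 * (1 + 2 * m)))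
    (hp0 : 0 < p) (hp1 : p ≤ 1) (hπ0 : 0 < π₀) (hw0 : 0 < w) (hw : 4 * w ≤ β)
    (hnpw : n * p * w ^ 2 = Real.log n) (hπw : m * π₀ ^ 2 ≤ 4 * θ * w ^ 2)
    (hL : 768 * m ^ 2 / η ^ 2 ≤ Real.log n) (hn : 2 ≤ η / (32 * m) * n) :
    1 ≤ minimaxError n m p π₀ + ENNReal.ofReal (recoveryBound m β η n) := by
  have hm2 : (2 : ℝ) ≤ m := by exact_mod_cast hm
  have hβ0 : 0 < β := by rw [hβ]; linarith
  have hβ1 : β ≤ 1 / 8 := by rw [hβ]; linarith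
  have hη0 : 0 < η := by rw [hη]; positivity
  have hη1 : η ≤ 1 := by
    rw [hη, div_le_one (by positivity)]; linarith
  -- With this `ε` the adverse drift inside `S`, at most `ε n p (2 w)`, uses only half of the level
  -- `n p η w / (8 m)` reached by the outer score.
  obtain ⟨ε, hε⟩ : ∃ ε, ε = η / (32 * m) := ⟨_, rfl⟩
  rw [← hε] at hn
  have hε0 : 0 < ε := by rw [hε]; positivity
  have hεh : ε ≤ 1 / 2 := by
    rw [hε, div_le_iff₀ (by positivity)]; linarith
  have hn0 : (0 : ℝ) < n := by
    by_contra hc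
    nlinarith
  have hn0' : 0 < n := Nat.cast_pos.1 hn0
  have hL0 : 0 < Real.log n := by rw [← hnpw]; positivity
  have hπ2w : π₀ ≤ 2 * w := by
    refine abs_le_of_sq_le_sq' ?_ (by linarith) |>.2
    nlinarith [sq_nonneg π₀, sq_nonneg w]
  have hπ : π₀ ∈ Set.Icc (0 : ℝ) 1 := ⟨hπ0.le, by linarith⟩
  have hp : p ∈ Set.Icc (0 : ℝ) 1 := ⟨hp0.le, hp1⟩
  let i₀ : Fin n := ⟨0, hn0'⟩
  have hs1 : (⌊ε * n⌋₊ : ℝ) ≤ ε * n := Nat.floor_le (by positivity)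
  have hs2 : ε * n / 2 ≤ (⌊ε * n⌋₊ : ℝ) := by
    have := Nat.lt_floor_add_one (ε * n)
    linarith
  obtain ⟨S, hS, hScard⟩ : ∃ S ⊆ Finset.univ.erase i₀, S.card = ⌊ε * n⌋₊ := by
    refine Finset.exists_subset_card_eq ?_
    rw [Finset.card_erase_of_mem (Finset.mem_univ _), Finset.card_univ, Fintype.card_fin]
    refine Nat.le_sub_one_of_lt ?_
    have : (⌊ε * n⌋₊ : ℝ) < n := by nlinarith
    exact_mod_cast this
  rw [← hScard] at hs1 hs2
  have hSn : (S.card : ℝ) ≤ n / 2 := by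
    have : ε * n ≤ 1 / 2 * n := by gcongr
    linarith
  have hScompl : (Sᶜ.card : ℝ) = n - S.card := by
    rw [Finset.card_compl, Fintype.card_fin, Nat.cast_sub]
    simpa using S.card_le_univ
  obtain ⟨t, M, μ, h, ht, hh, hM, hM0, hμ, hD, hα⟩ := exists_tilt (N := Sᶜ.card) (π := π₀) hm2 hn0
    (by rw [hScompl]; linarith) (by rw [hScompl]; linarith [S.card.cast_nonneg (α := ℝ)]) hp0 hp1 hπ0.le hθ0 hθ1 hβ hη hw0 hw
    hnpw hπw hL rfl rfl
  refine one_le_minimaxError_add hp hπ i₀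
    (fun x => {y | ∀ i ∈ S, totalScore x (x + Pi.single i 1) Finset.univ y ≤ 0}) ?_ ?_
  · intro x hx y hy hne
    simp only [Set.mem_ofPred_eq, not_forall, not_le] at hy
    obtain ⟨i, hi, hlt⟩ := hy
    refine ⟨x + Pi.single i 1, ?_, dataLaw_singleton_lt hp hπ0 (by linarith) hlt hne⟩
    have : i₀ ≠ i := (Finset.ne_of_mem_erase (hS hi)).symm
    simp [hx, Pi.single_eq_of_ne this]
  · intro x _
    have hsπ : S.card * (p * π₀) ≤ n * p * η * w / (16 * m) := by
      calc S.card * (p * π₀) ≤ ε * n * (p * (2 * w)) := by gcongr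
        _ = _ := by rw [hε]; field_simp; norm_num
    have hh' : n * p * η * w / (16 * m) ≤ n * p * η * w / (8 * m) - S.card * (p * π₀) := by
      have : n * p * η * w / (8 * m) = 2 * (n * p * η * w / (16 * m)) := by field_simp; norm_num
      linarith
    refine (dataLaw_totalScore_le hm hp hπ x S rfl rfl ht hh hM hM0 hμ
      (h' := n * p * η * w / (16 * m)) (by positivity) ?_).trans ?_
    · have : p * ((1 - π₀) / m + π₀) - p * ((1 - π₀) / m) = p * π₀ := by ring
      rw [this]
      linarith
    · refine add_le_add ?_ ?_
      · refine Real.exp_le_exp.2 (neg_le_neg ?_)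
        calc η / (128 * m) * Real.exp (5 * β * Real.log n)
            = 1 / 2 * Real.exp (-((θ + 3 * β) * Real.log n)) * (ε * n / 2) := by
              have h1 : (n : ℝ) = Real.exp (Real.log n) := (Real.exp_log hn0).symm
              -- The exponent left is `1 - θ - 3 β = 5 β`, as `1 - θ = 8 β`.
              have h2 : 5 * β * Real.log n = -((θ + 3 * β) * Real.log n) + Real.log n := by
                rw [hβ]; ring
              rw [h2, Real.exp_add, ← h1, hε]
              ring
          _ ≤ _ := by
              refine mul_le_mul hα hs2 (by positivity) ?_
              exact le_trans (by positivity) hα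
      · have h1 : p * ((1 - π₀) / m) + p * ((1 - π₀) / m + π₀) ≤ 2 * p := by
          have : (1 - π₀) / m ≤ (1 - π₀) / 2 := by
            have := hπ.2
            gcongr
          have h5 : p * (2 * ((1 - π₀) / m) + π₀) ≤ p * 2 := by
            gcongr; linarith [hπ.2]
          linarith
        have h2 : (S.card : ℝ) ≤ n := by linarith
        have h3 : 0 ≤ (1 - π₀) / m := div_nonneg (by linarith [hπ.2]) (by positivity)
        calc _ ≤ n * (2 * p) / (n * p * η * w / (16 * m)) ^ 2 := by gcongr
          _ = _ := by rw [← hnpw]; field_simp; norm_num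

end Minimax

end JointAlignment

end

/-! ### Passage to the limit. -/

theorem theorem2 (m : ℕ) [NeZero m] (hm : 2 ≤ m) (θ : ℝ) (hθ₀ : 0 < θ) (hθ₁ : θ < 1) :
    ∃ c₁ : ℝ, 0 < c₁ ∧
      ∀ p π₀ : ℕ → ℝ,
        (∀ n, p n ∈ Set.Icc (0 : ℝ) 1) →
        (∀ n, π₀ n ∈ Set.Icc (0 : ℝ) 1) →
        (∀ᶠ n : ℕ in atTop, c₁ * Real.log n / n < p n) →
        (∀ᶠ n : ℕ in atTop, π₀ n < 2 * Real.sqrt (θ * Real.log n / (m * n * p n))) →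
        Tendsto (fun n : ℕ => JointAlignment.minimaxError n m (p n) (π₀ n)) atTop (𝓝 1) := by
  obtain ⟨β, hβ⟩ : ∃ β, β = (1 - θ) / 8 := ⟨_, rfl⟩
  obtain ⟨η, hη⟩ : ∃ η, η = β / (12 * (1 + 2 * (m : ℝ))) := ⟨_, rfl⟩
  have hβ0 : 0 < β := by rw [hβ]; linarith
  have hη0 : 0 < η := by rw [hη]; positivity
  have hm0 : (0 : ℝ) < m := by exact_mod_cast (by omega : 0 < m)
  -- This `c₁` forces `w = √(log n / (n p))` to be at most `β / 4`.
  refine ⟨16 / β ^ 2, by positivity, fun p π₀ hp hπ hpn hπn => ?_⟩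
  have hlog : Tendsto (fun n : ℕ => Real.log n) atTop atTop :=
    Real.tendsto_log_atTop.comp tendsto_natCast_atTop_atTop
  have hb0 := JointAlignment.tendsto_recoveryBound (m := m) (by omega) hβ0 hη0
  have hb1 : Tendsto (fun n : ℕ => 1 / ((n - 1 : ℕ) : ℝ)) atTop (𝓝 0) :=
    tendsto_const_nhds.div_atTop
      (tendsto_natCast_atTop_atTop.comp (tendsto_sub_atTop_nat 1))
  have hb : Tendsto (fun n : ℕ => 1 - ENNReal.ofReal
      (max (JointAlignment.recoveryBound m β η n) (1 / ((n - 1 : ℕ) : ℝ)))) atTop (𝓝 1) := by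
    have h1 := ENNReal.tendsto_ofReal (hb0.max hb1)
    have h2 := ENNReal.Tendsto.sub (tendsto_const_nhds (x := (1 : ℝ≥0∞)) (f := atTop)) h1
      (.inl ENNReal.one_ne_top)
    simpa using h2
  refine tendsto_of_tendsto_of_tendsto_of_le_of_le' hb tendsto_const_nhds ?_
    (.of_forall fun n => JointAlignment.minimaxError_le_one (hp n) (hπ n))
  filter_upwards [hpn, hπn, hlog.eventually_ge_atTop (768 * m ^ 2 / η ^ 2),
    (tendsto_natCast_atTop_atTop.const_mul_atTop
      (show 0 < η / (32 * m) by positivity)).eventually_ge_atTop 2,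
    eventually_ge_atTop 2] with n h1 h2 h3 h4 h5
  rw [tsub_le_iff_right]
  have hn0 : (0 : ℝ) < n := by exact_mod_cast (by omega : 0 < n)
  rcases (hπ n).1.eq_or_lt with h0 | h0
  · rw [← h0]
    refine (JointAlignment.one_le_minimaxError_zero_add hm (hp n) h5).trans ?_
    gcongr
    exact le_max_right _ _
  · have hL0 : 0 < Real.log n := lt_of_lt_of_le (by positivity) h3
    have hp0 : 0 < p n := lt_trans (by positivity) h1
    have hwsq : √(Real.log n / (n * p n)) ^ 2 = Real.log n / (n * p n) :=
      Real.sq_sqrt (by positivity)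
    refine (JointAlignment.one_le_minimaxError_add_recoveryBound hm
      (w := √(Real.log n / (n * p n))) hθ₀ hθ₁ hβ hη hp0 (hp n).2 h0
      (Real.sqrt_pos.2 (by positivity)) ?_ ?_ ?_ h3 h4).trans ?_
    · have : √(Real.log n / (n * p n)) ≤ β / 4 := by
        rw [Real.sqrt_le_left (by positivity), div_le_iff₀ (by positivity)]
        rw [div_lt_iff₀ hn0, div_mul_eq_mul_div, div_lt_iff₀ (by positivity)] at h1
        linarith
      linarith
    · rw [hwsq]; field_simp
    · rw [hwsq]
      have h6 : π₀ n ^ 2 ≤ (2 * √(θ * Real.log n / (m * n * p n))) ^ 2 := by gcongr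
      rw [mul_pow, Real.sq_sqrt (by positivity)] at h6
      calc m * π₀ n ^ 2 ≤ m * (2 ^ 2 * (θ * Real.log n / (m * n * p n))) := by gcongr
        _ = _ := by field_simp; norm_num
    · gcongr
      exact le_max_left _ _
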